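/- All C*-algebras are complex and unital. For a C*-algebra $A$ let $S(A)\subset A^*$ denote its state space (the positive linear functionals $\varphi$ with $\varphi(1)=1$), with the weak-$*$ topology $\sigma(A^*,A)$. Let $A\otimes B$ denote the injective (spatial, minimal) C*-tensor product of two C*-algebras $A$ and $B$, that is, the norm closure of the algebraic tensor product in the bounded operators on the Hilbert space tensor product of the spaces of the universal representations of $A$ and $B$ (or of any faithful representations). For $\varphi\in S(A)$ and $\psi\in S(B)$ let $\varphi\otimes\psi\in S(A\otimes B)$ be the unique state with $(\varphi\otimes\psi)(a\otimes b)=\varphi(a)\psi(b)$ for all $a\in A$, $b\in B$. Let $S(A)\otimes S(B)=\{\varphi\otimes\psi : \varphi\in S(A),\ \psi\in S(B)\}$ be the set of product states; a state in its weak-$*$ closed convex hull in $(A\otimes B)^*$ is called separable. Let $A$ and $B$ be C*-algebras. Then the set $S(A)\otimes S(B)$ is weak-$*$ compact, and for every separable state $\omega$ on $A\otimes B$ there exists a regular Borel probability measure $\nu$ on $S(A)\otimes S(B)$ such that $$\omega=\int_{S(A)\otimes S(B)}\varphi\otimes\psi\; d\nu(\varphi\otimes\psi)$$ as a barycenter,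 i.e. $f(\omega)=\int f(\varphi\otimes\psi)\,d\nu(\varphi\otimes\psi)$ for every weak-$*$ continuous linear functional $f$ on $(A\otimes B)^*$. -/

import Mathlib

open scoped TensorProduct ComplexOrder InnerProductSpace ENNReal
open MeasureTheory UniformSpace

noncomputable section

namespace CStarSep

universe u v

/-! ### States -/

/-- The state space `S(A)` of a unital C*-algebra `A`: the positive normalized continuous linear
functionals, as a subset of the dual space `A*` with the weak-* topology. Positivity means
`0 ≤ φ (a* a)` for all `a`, the positive elements of a C*-algebra being the elements `a* a`. -/
def stateSpace (A : Type u) [CStarAlgebra A] : Set (WeakDual ℂ A) :=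
  {φ | (∀ a : A, 0 ≤ φ (star a * a)) ∧ φ 1 = 1}

/-! ### Direct sums of representations -/

section DirectSum

variable {ι : Type u} {H : ι → Type v} [∀ i, NormedAddCommGroup (H i)]
  [∀ i, InnerProductSpace ℂ (H i)]

lemma memlp_diag {T : ∀ i, H i →L[ℂ] H i} {C : ℝ} (hT : ∀ i, ‖T i‖ ≤ C) (x : lp H 2) :
    Memℓp (fun i => T i (x i)) 2 :=
  Memℓp.mono ((lp.memℓp x).norm.const_mul C) fun i =>
    ((T i).le_opNorm _).trans (mul_le_mul_of_nonneg_right (hT i) (norm_nonneg _))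

/-- The diagonal operator on a Hilbert space direct sum given by a bounded family of operators. -/
def diag (T : ∀ i, H i →L[ℂ] H i) (C : ℝ) (hT : ∀ i, ‖T i‖ ≤ C) : lp H 2 →L[ℂ] lp H 2 :=
  LinearMap.mkContinuous
    { toFun := fun x => ⟨fun i => T i (x i), memlp_diag hT x⟩
      map_add' := fun x y => by ext i; simp; rfl
      map_smul' := fun c x => by ext i; simp }
    |C| (fun x => by
      have h2 : 0 < (2 : ℝ≥0∞).toReal := by norm_num
      refine lp.norm_le_of_tsum_le h2 (by positivity) ?_
      rw [Real.mul_rpow (abs_nonneg C) (norm_nonneg x), lp.norm_rpow_eq_tsum h2, ← tsum_mul_left]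
      refine Summable.tsum_le_tsum (fun i => ?_)
        ((memlp_diag hT x).summable h2) (((lp.memℓp x).summable h2).mul_left _)
      rw [← Real.mul_rpow (abs_nonneg C) (norm_nonneg _)]
      refine Real.rpow_le_rpow (norm_nonneg _) ?_ h2.le
      exact ((T i).le_opNorm _).trans
        (mul_le_mul_of_nonneg_right ((hT i).trans (le_abs_self C)) (norm_nonneg _)))

@[simp] lemma diag_apply (T : ∀ i, H i →L[ℂ] H i) (C : ℝ) (hT : ∀ i, ‖T i‖ ≤ C) (x : lp H 2)
    (i : ι) : diag T C hT x i = T i (x i) := rfl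

variable [∀ i, CompleteSpace (H i)] {A : Type*} [CStarAlgebra A]

/-- The direct sum of a family of representations, on the Hilbert space direct sum. -/
def directSumRep (π : ∀ i, A →⋆ₐ[ℂ] (H i →L[ℂ] H i)) : A →⋆ₐ[ℂ] (lp H 2 →L[ℂ] lp H 2) where
  toFun a := diag (fun i => π i a) ‖a‖ fun i => NonUnitalStarAlgHom.norm_apply_le (π i) a
  map_one' := by ext x i; simp
  map_mul' a b := by ext x i; simp
  map_zero' := by ext x i; simp
  map_add' a b := by ext x i; simp
  commutes' c := by ext x i; simp [Algebra.algebraMap_eq_smul_one]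
  map_star' a := by
    rw [ContinuousLinearMap.star_eq_adjoint, ContinuousLinearMap.eq_adjoint_iff]
    intro x y
    rw [lp.inner_eq_tsum, lp.inner_eq_tsum]
    refine tsum_congr fun i => ?_
    rw [diag_apply, diag_apply, map_star, ContinuousLinearMap.star_eq_adjoint,
      ContinuousLinearMap.adjoint_inner_left]

@[simp] lemma directSumRep_apply (π : ∀ i, A →⋆ₐ[ℂ] (H i →L[ℂ] H i)) (a : A) (x : lp H 2)
    (i : ι) : directSumRep π a x i = π i a (x i) := rfl

end DirectSum

/-! ### The universal representation -/

section Universal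

/- The canonical order of a C*-algebra: `a ≤ b` iff `b - a` is selfadjoint with nonnegative
spectrum. -/
attribute [local instance 50] CStarAlgebra.spectralOrder CStarAlgebra.spectralOrderedRing

variable {A : Type u} [CStarAlgebra A]

/-- A state, as a positive linear map for the canonical order of `A`. -/
def toPositive (φ : stateSpace A) : A →ₚ[ℂ] ℂ :=
  PositiveLinearMap.mk₀ (φ.1 : A →ₗ[ℂ] ℂ) (by
    intro x hx
    obtain ⟨y, rfl⟩ := CStarAlgebra.nonneg_iff_eq_star_mul_self.mp hx
    exact φ.2.1 y)

/-- The Gelfand-Naimark-Segal Hilbert space of a state. -/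
abbrev GNSSpace (φ : stateSpace A) : Type u := (toPositive φ).GNS

/-- The Gelfand-Naimark-Segal representation of a state. -/
def gnsRep (φ : stateSpace A) : A →⋆ₐ[ℂ] (GNSSpace φ →L[ℂ] GNSSpace φ) :=
  (toPositive φ).gnsStarAlgHom

/-- The Hilbert space of the universal representation: the Hilbert space direct sum of the
Gelfand-Naimark-Segal spaces of all the states. -/
abbrev UnivSpace (A : Type u) [CStarAlgebra A] : Type u :=
  lp (fun φ : stateSpace A => GNSSpace φ) 2

/-- The universal representation of `A`. -/
def univRep (A : Type u) [CStarAlgebra A] : A →⋆ₐ[ℂ] (UnivSpace A →L[ℂ] UnivSpace A) :=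
  directSumRep gnsRep

/-- The cyclic vector of the Gelfand-Naimark-Segal representation. -/
def cyc (φ : stateSpace A) : GNSSpace φ :=
  (((toPositive φ).toPreGNS 1 : (toPositive φ).PreGNS) : Completion _)

lemma cyc_inner (φ : stateSpace A) (a : A) : ⟪cyc φ, gnsRep φ a (cyc φ)⟫_ℂ = φ.1 a := by
  change ⟪(((toPositive φ).toPreGNS 1 : (toPositive φ).PreGNS) : Completion _),
    (toPositive φ).gnsNonUnitalStarAlgHom a
      (((toPositive φ).toPreGNS 1 : (toPositive φ).PreGNS) : Completion _)⟫_ℂ = _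
  rw [PositiveLinearMap.gnsNonUnitalStarAlgHom_apply_coe, Completion.inner_coe,
    PositiveLinearMap.preGNS_inner_def]
  simp
  rfl

open Classical in
/-- The cyclic vector of a state, in the space of the universal representation. -/
def univCyc (φ : stateSpace A) : UnivSpace A := lp.single 2 φ (cyc φ)

lemma univCyc_inner (φ : stateSpace A) (a : A) :
    ⟪univCyc φ, univRep A a (univCyc φ)⟫_ℂ = φ.1 a := by
  classical
  rw [univCyc, lp.inner_single_left, univRep, directSumRep_apply, lp.single_apply_self, cyc_inner]

end Universal

/-! ### The injective tensor product -/

section Spatial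

variable {A : Type u} {B : Type v} [CStarAlgebra A] [CStarAlgebra B]
variable {H K : Type*} [NormedAddCommGroup H] [InnerProductSpace ℂ H]
  [NormedAddCommGroup K] [InnerProductSpace ℂ K]

/-- The Hilbert space tensor product: the completion of the algebraic tensor product for the inner
product `⟪x ⊗ y, x' ⊗ y'⟫ = ⟪x, x'⟫ * ⟪y, y'⟫`. -/
def HilbertTensor (H K : Type*) [NormedAddCommGroup H] [InnerProductSpace ℂ H]
    [NormedAddCommGroup K] [InnerProductSpace ℂ K] : Type _ := Completion (H ⊗[ℂ] K)

instance : NormedAddCommGroup (HilbertTensor H K) :=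
  inferInstanceAs (NormedAddCommGroup (Completion (H ⊗[ℂ] K)))

instance : InnerProductSpace ℂ (HilbertTensor H K) :=
  inferInstanceAs (InnerProductSpace ℂ (Completion (H ⊗[ℂ] K)))

instance : CompleteSpace (HilbertTensor H K) :=
  inferInstanceAs (CompleteSpace (Completion (H ⊗[ℂ] K)))

/-- The bounded operators on the Hilbert space tensor product. -/
abbrev TensorOp (H K : Type*) [NormedAddCommGroup H] [InnerProductSpace ℂ H]
    [NormedAddCommGroup K] [InnerProductSpace ℂ K] : Type _ :=
  HilbertTensor H K →L[ℂ] HilbertTensor H K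

/-- The inclusion of the algebraic tensor product in the Hilbert space tensor product. -/
def incl : (H ⊗[ℂ] K) →ₗᵢ[ℂ] HilbertTensor H K :=
  (Completion.toComplₗᵢ : (H ⊗[ℂ] K) →ₗᵢ[ℂ] Completion (H ⊗[ℂ] K))

lemma denseRange_incl : DenseRange (incl : (H ⊗[ℂ] K) →ₗᵢ[ℂ] HilbertTensor H K) :=
  Completion.denseRange_coe

/-- The operator `S ⊗ T` on the Hilbert space tensor product. -/
def opTensor (S : H →L[ℂ] H) (T : K →L[ℂ] K) : TensorOp H K :=
  (TensorProduct.mapL S T).completion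

lemma opTensor_incl (S : H →L[ℂ] H) (T : K →L[ℂ] K) (x : H ⊗[ℂ] K) :
    opTensor S T (incl x) = incl (TensorProduct.mapL S T x) :=
  ContinuousLinearMap.completion_apply_coe _ _

lemma op_ext {S T : TensorOp H K}
    (h : ∀ (x : H) (y : K), S (incl (x ⊗ₜ[ℂ] y)) = T (incl (x ⊗ₜ[ℂ] y))) : S = T := by
  ext z
  induction z using denseRange_incl.induction_on with
  | hp => exact isClosed_eq S.continuous T.continuous
  | ih z =>
    induction z using TensorProduct.induction_on with
    | zero => rw [map_zero, map_zero, map_zero]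
    | tmul x y => exact h x y
    | add z w hz hw => rw [map_add, map_add, map_add, hz, hw]

lemma opTensor_tmul (S : H →L[ℂ] H) (T : K →L[ℂ] K) (x : H) (y : K) :
    opTensor S T (incl (x ⊗ₜ[ℂ] y)) = incl (S x ⊗ₜ[ℂ] T y) := by
  rw [opTensor_incl, TensorProduct.mapL_tmul]

lemma opTensor_mul (S S' : H →L[ℂ] H) (T T' : K →L[ℂ] K) :
    opTensor (S * S') (T * T') = opTensor S T * opTensor S' T' :=
  op_ext fun x y => by simp [opTensor_tmul]

lemma opTensor_one : opTensor (1 : H →L[ℂ] H) (1 : K →L[ℂ] K) = 1 :=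
  op_ext fun x y => by simp [opTensor_tmul]

/-- The bilinear map `(S, T) ↦ S ⊗ T`. -/
def opTensorBilin : (H →L[ℂ] H) →ₗ[ℂ] (K →L[ℂ] K) →ₗ[ℂ]
    TensorOp H K :=
  LinearMap.mk₂ ℂ opTensor
    (fun S S' T => op_ext fun x y => by
      simp [opTensor_tmul, TensorProduct.add_tmul])
    (fun c S T => op_ext fun x y => by
      rw [smul_apply, opTensor_tmul, opTensor_tmul,
        smul_apply, ← TensorProduct.smul_tmul', map_smul])
    (fun S T T' => op_ext fun x y => by
      simp [opTensor_tmul, TensorProduct.tmul_add])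
    (fun c S T => op_ext fun x y => by
      rw [smul_apply, opTensor_tmul, opTensor_tmul,
        smul_apply, TensorProduct.tmul_smul, map_smul])

@[simp] lemma opTensorBilin_apply (S : H →L[ℂ] H) (T : K →L[ℂ] K) :
    opTensorBilin S T = opTensor S T := rfl

variable [CompleteSpace H] [CompleteSpace K]

lemma opTensor_star (S : H →L[ℂ] H) (T : K →L[ℂ] K) :
    opTensor (star S) (star T) = star (opTensor S T) := by
  rw [ContinuousLinearMap.star_eq_adjoint (opTensor S T), ContinuousLinearMap.eq_adjoint_iff]
  intro z w
  induction z, w using denseRange_incl.induction_on₂ with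
  | hp => apply isClosed_eq <;> fun_prop
  | h z w =>
    rw [opTensor_incl, opTensor_incl, LinearIsometry.inner_map_map, LinearIsometry.inner_map_map]
    induction z using TensorProduct.induction_on with
    | zero => simp
    | add z z' h h' => rw [map_add, inner_add_left, inner_add_left, h, h']
    | tmul x y =>
      induction w using TensorProduct.induction_on with
      | zero => simp
      | add z z' h h' => rw [map_add, inner_add_right, inner_add_right, h, h']
      | tmul x' y' =>
        simp [-TensorProduct.mapL_apply, TensorProduct.mapL_tmul,
          ContinuousLinearMap.star_eq_adjoint, ContinuousLinearMap.adjoint_inner_left]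

/-- The algebra homomorphism `a ⊗ b ↦ π a ⊗ ρ b` on the algebraic tensor product. -/
def tensorRepAlg (π : A →⋆ₐ[ℂ] (H →L[ℂ] H)) (ρ : B →⋆ₐ[ℂ] (K →L[ℂ] K)) :
    A ⊗[ℂ] B →ₐ[ℂ] TensorOp H K :=
  Algebra.TensorProduct.algHomOfLinearMapTensorProduct
    (TensorProduct.lift (opTensorBilin.compl₁₂ π.toAlgHom.toLinearMap ρ.toAlgHom.toLinearMap))
    (fun a a' b b' => by
      change opTensor (π (a * a')) (ρ (b * b')) = opTensor (π a) (ρ b) * opTensor (π a') (ρ b')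
      rw [map_mul, map_mul, opTensor_mul])
    (by
      change opTensor (π 1) (ρ 1) = 1
      rw [map_one, map_one, opTensor_one])

lemma tensorRepAlg_tmul (π : A →⋆ₐ[ℂ] (H →L[ℂ] H)) (ρ : B →⋆ₐ[ℂ] (K →L[ℂ] K))
    (a : A) (b : B) : tensorRepAlg π ρ (a ⊗ₜ[ℂ] b) = opTensor (π a) (ρ b) := rfl

/-- The representation `π ⊗ ρ` of the algebraic tensor product on the Hilbert space tensor
product, `(π ⊗ ρ) (a ⊗ b) = π a ⊗ ρ b`. -/
def tensorRep (π : A →⋆ₐ[ℂ] (H →L[ℂ] H)) (ρ : B →⋆ₐ[ℂ] (K →L[ℂ] K)) :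
    A ⊗[ℂ] B →⋆ₐ[ℂ] TensorOp H K :=
  { tensorRepAlg π ρ with
    map_star' := fun z => by
      change tensorRepAlg π ρ (star z) = star (tensorRepAlg π ρ z)
      induction z using TensorProduct.induction_on with
      | zero => rw [star_zero, map_zero]; exact (star_zero _).symm
      | tmul a b =>
        rw [TensorProduct.star_tmul, tensorRepAlg_tmul, tensorRepAlg_tmul, map_star, map_star,
          opTensor_star]
      | add z w hz hw => rw [star_add, map_add, map_add, hz, hw]; exact (star_add _ _).symm }

@[simp] lemma tensorRep_tmul (π : A →⋆ₐ[ℂ] (H →L[ℂ] H)) (ρ : B →⋆ₐ[ℂ] (K →L[ℂ] K))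
    (a : A) (b : B) : tensorRep π ρ (a ⊗ₜ[ℂ] b) = opTensor (π a) (ρ b) := rfl

end Spatial

variable (A : Type u) (B : Type v) [CStarAlgebra A] [CStarAlgebra B]

/-- The injective (spatial) C*-tensor product of `A` and `B`: the norm closure of the algebraic
tensor product `A ⊗ B` in the bounded operators on the Hilbert space tensor product of the
universal representations of `A` and `B`, which are faithful. -/
def injSubalgebra : StarSubalgebra ℂ (TensorOp (UnivSpace A) (UnivSpace B)) :=
  (tensorRep (univRep A) (univRep B)).range.topologicalClosure

instance : IsClosed (injSubalgebra A B : Set (TensorOp (UnivSpace A) (UnivSpace B))) :=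
  StarSubalgebra.isClosed_topologicalClosure _

/-- The injective C*-tensor product, as a C*-algebra. -/
def InjTensor : Type (max u v) := injSubalgebra A B

instance : CStarAlgebra (InjTensor A B) :=
  inferInstanceAs (CStarAlgebra (injSubalgebra A B))

/-- The inclusion of the injective tensor product in the bounded operators. -/
def InjTensor.toOp : InjTensor A B →⋆ₐ[ℂ] TensorOp (UnivSpace A) (UnivSpace B) :=
  (injSubalgebra A B).subtype

/-- The canonical map from the algebraic to the injective tensor product. -/
def InjTensor.ofAlg : A ⊗[ℂ] B →⋆ₐ[ℂ] InjTensor A B :=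
  (tensorRep (univRep A) (univRep B)).codRestrict (injSubalgebra A B)
    fun z => StarSubalgebra.le_topologicalClosure _ ⟨z, rfl⟩

variable {A B}

lemma InjTensor.continuous_toOp : Continuous (InjTensor.toOp A B) := continuous_subtype_val

lemma InjTensor.denseRange_ofAlg : DenseRange (InjTensor.ofAlg A B) := by
  intro x
  change (x : injSubalgebra A B) ∈ closure (X := injSubalgebra A B) _
  refine closure_subtype.mpr ?_
  refine closure_mono ?_ x.2
  rintro _ ⟨z, rfl⟩
  exact ⟨InjTensor.ofAlg A B z, ⟨z, rfl⟩, rfl⟩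

/-- The elementary tensor `a ⊗ b` in the injective C*-tensor product. -/
def InjTensor.tmul (a : A) (b : B) : InjTensor A B := InjTensor.ofAlg A B (a ⊗ₜ[ℂ] b)

/-! ### Product states and separable states -/

/-- `ω` is the product state `φ ⊗ ψ`: the state on the injective tensor product with
`(φ ⊗ ψ) (a ⊗ b) = φ a * ψ b`. -/
def IsProduct (ω : WeakDual ℂ (InjTensor A B)) (φ : WeakDual ℂ A) (ψ : WeakDual ℂ B) : Prop :=
  ω ∈ stateSpace (InjTensor A B) ∧ ∀ (a : A) (b : B), ω (InjTensor.tmul a b) = φ a * ψ b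

lemma exists_isProduct (φ : stateSpace A) (ψ : stateSpace B) :
    ∃ ω : WeakDual ℂ (InjTensor A B), IsProduct ω φ.1 ψ.1 := by
  let ξ : HilbertTensor (UnivSpace A) (UnivSpace B) := incl (univCyc φ ⊗ₜ[ℂ] univCyc ψ)
  let L : InjTensor A B →L[ℂ] ℂ :=
    ⟨(innerSL ℂ ξ).toLinearMap ∘ₗ (ContinuousLinearMap.apply ℂ _ ξ).toLinearMap ∘ₗ
      (InjTensor.toOp A B).toAlgHom.toLinearMap,
      ((innerSL ℂ ξ).continuous.comp (ContinuousLinearMap.apply ℂ _ ξ).continuous).comp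
        InjTensor.continuous_toOp⟩
  have hL (x : InjTensor A B) : L x = ⟪ξ, InjTensor.toOp A B x ξ⟫_ℂ := rfl
  have key (a : A) (b : B) : L (InjTensor.tmul a b) = φ.1 a * ψ.1 b := by
    rw [hL]
    change ⟪incl (univCyc φ ⊗ₜ[ℂ] univCyc ψ),
      opTensor (univRep A a) (univRep B b) (incl _)⟫_ℂ = _
    rw [opTensor_tmul, LinearIsometry.inner_map_map, TensorProduct.inner_tmul, univCyc_inner,
      univCyc_inner]
  have h1 : (1 : InjTensor A B) = InjTensor.tmul 1 1 :=
    (map_one (InjTensor.ofAlg A B)).symm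
  refine ⟨StrongDual.toWeakDual L, ⟨fun x => ?_, ?_⟩, key⟩
  · change 0 ≤ L (star x * x)
    rw [hL, map_mul, map_star]
    change 0 ≤ ⟪ξ, (star (InjTensor.toOp A B x)) (InjTensor.toOp A B x ξ)⟫_ℂ
    rw [ContinuousLinearMap.star_eq_adjoint, ContinuousLinearMap.adjoint_inner_right,
      inner_self_eq_norm_sq_to_K, ← RCLike.ofReal_pow]
    exact Complex.zero_le_real.mpr (sq_nonneg _)
  · change L 1 = 1
    rw [h1, key, φ.2.2, ψ.2.2, one_mul]

/-- For states `φ` and `ψ` there is exactly one product state `φ ⊗ ψ`. -/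
theorem existsUnique_isProduct (φ : stateSpace A) (ψ : stateSpace B) :
    ∃! ω : WeakDual ℂ (InjTensor A B), IsProduct ω φ.1 ψ.1 := by
  obtain ⟨ω, hω⟩ := exists_isProduct φ ψ
  refine ⟨ω, hω, fun ω' hω' => ?_⟩
  have h (z : A ⊗[ℂ] B) : ω' (InjTensor.ofAlg A B z) = ω (InjTensor.ofAlg A B z) := by
    induction z using TensorProduct.induction_on with
    | zero => rw [map_zero, map_zero, map_zero]
    | tmul a b => exact (hω'.2 a b).trans (hω.2 a b).symm
    | add z w hz hw => rw [map_add, map_add, map_add, hz, hw]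
  exact DFunLike.coe_injective
    (InjTensor.denseRange_ofAlg.equalizer (map_continuous ω') (map_continuous ω) (funext h))

variable (A B)

/-- The set `S(A) ⊗ S(B)` of product states. -/
def productStates : Set (WeakDual ℂ (InjTensor A B)) :=
  {ω | ∃ φ ∈ stateSpace A, ∃ ψ ∈ stateSpace B, IsProduct ω φ ψ}

/-- The set of separable states: the weak-* closed convex hull of the product states. -/
def separableStates : Set (WeakDual ℂ (InjTensor A B)) :=
  closedConvexHull ℝ (productStates A B)

variable {A B}

/-! ### Barycenters -/

/-- The measure `μ` on a subset `K` of a complex topological vector space represents the point `x`,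
that is, `x` is its barycenter `∫_K y dμ(y)`: `f x = ∫_K f dμ` for every continuous linear
functional `f`. -/
def Represents {E : Type*} [AddCommGroup E] [Module ℂ E] [TopologicalSpace E] {K : Set E}
    [MeasurableSpace K] (μ : Measure K) (x : E) : Prop :=
  ∀ f : E →L[ℂ] ℂ, Integrable (fun y : K => f y) μ ∧ f x = ∫ y : K, f y ∂μ

/-- The Borel sets of the set of product states, for the weak-* topology. -/
instance : MeasurableSpace (productStates A B) := borel (productStates A B)

instance : BorelSpace (productStates A B) := ⟨rfl⟩

end CStarSep

end

namespace CStarSep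

/-! ### Barycenters of probability measures on a compact set -/

section Barycenter

variable {E : Type*} [AddCommGroup E] [Module ℂ E] [TopologicalSpace E] {K : Set E}
  [MeasurableSpace K]

/-! Let `K` be compact Hausdorff and let `R` be the set of barycenters of probability measures on
`K`. Point masses put `K` inside `R`, and mixing measures makes `R` convex. Moreover `R` is closed
(`isClosed_represented`), since it is the projection of a closed relation along the weakly compact
space of probability measures. So `R` contains the closed convex hull of `K`, with no appeal to
Hahn-Banach separation. A Borel measure on a nonmetrizable `K` need not be regular, so the measure
is replaced at the end by a regular one with the same integrals of continuous functions.

Compactness of the product states follows from Banach-Alaoglu once they are described by closed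
conditions on `ω` alone (`mem_productStates_iff`). -/

/-- Continuous functions on a compact space are integrable for a finite measure, so only the
equations remain. -/
lemma represents_iff_of_compactSpace [BorelSpace K] [CompactSpace K] {μ : Measure K}
    [IsFiniteMeasure μ] {x : E} :
    Represents μ x ↔ ∀ f : E →L[ℂ] ℂ, f x = ∫ y : K, f y ∂μ := by
  refine forall_congr' fun f => and_iff_right ?_
  exact Continuous.integrable_of_hasCompactSupport (by fun_prop)
    (HasCompactSupport.of_compactSpace _)

/-- The weak topology tests against bounded continuous functions; compactness makes `g` bounded. -/
lemma continuous_integral_of_compactSpace {X : Type*} [TopologicalSpace X] [CompactSpace X]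
    [MeasurableSpace X] [BorelSpace X] {g : X → ℂ} (hg : Continuous g) :
    Continuous fun μ : ProbabilityMeasure X => ∫ y, g y ∂(μ : Measure X) := by
  refine continuous_iff_continuousAt.2 fun μ => ?_
  exact (ProbabilityMeasure.tendsto_iff_forall_integral_rclike_tendsto ℂ).1 Filter.tendsto_id
    (BoundedContinuousFunction.mkOfCompact ⟨g, hg⟩)

/-- Both sides of each equation `f x = ∫ f dμ` are continuous in `(μ, x)`, so the relation is
closed. Its projection to `E` stays closed because `ProbabilityMeasure K` is compact. -/
lemma isClosed_represented [BorelSpace K] [CompactSpace K] [T2Space K] :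
    IsClosed {x : E | ∃ μ : ProbabilityMeasure K, Represents (μ : Measure K) x} := by
  have hC : IsClosed {p : ProbabilityMeasure K × E | Represents (p.1 : Measure K) p.2} := by
    simp only [represents_iff_of_compactSpace, Set.ofPred_forall]
    refine isClosed_iInter fun f => isClosed_eq (by fun_prop) ?_
    exact (continuous_integral_of_compactSpace (by fun_prop)).comp continuous_fst
  convert isClosedMap_snd_of_compactSpace _ hC using 1
  ext x
  simp

lemma convex_represented [Module ℝ E] [IsScalarTower ℝ ℂ E] :
    Convex ℝ {x : E | ∃ μ : ProbabilityMeasure K, Represents (μ : Measure K) x} := by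
  rintro x ⟨μ, hμ⟩ y ⟨ν, hν⟩ a b ha hb hab
  have hP : IsProbabilityMeasure
      (ENNReal.ofReal a • (μ : Measure K) + ENNReal.ofReal b • (ν : Measure K)) :=
    ⟨by simp [← ENNReal.ofReal_add ha hb, hab]⟩
  refine ⟨⟨_, hP⟩, fun f => ?_⟩
  obtain ⟨hμi, hμe⟩ := hμ f
  obtain ⟨hνi, hνe⟩ := hν f
  have h1 := hμi.smul_measure (c := ENNReal.ofReal a) ENNReal.ofReal_ne_top
  have h2 := hνi.smul_measure (c := ENNReal.ofReal b) ENNReal.ofReal_ne_top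
  refine ⟨h1.add_measure h2, ?_⟩
  rw [ProbabilityMeasure.coe_mk, integral_add_measure h1 h2, integral_smul_measure,
    integral_smul_measure, ← hμe, ← hνe, ENNReal.toReal_ofReal ha, ENNReal.toReal_ofReal hb,
    -- `f` is only complex linear, so the real weights are first read as complex scalars.
    map_add, ← algebraMap_smul ℂ a x, ← algebraMap_smul ℂ b y, map_smul, map_smul,
    algebraMap_smul, algebraMap_smul]

lemma represents_dirac [BorelSpace K] (x : K) : Represents (Measure.dirac x) (x : E) := fun f => by
  have hf : StronglyMeasurable fun y : K => f y :=
    (by fun_prop : Continuous fun y : K => f y).measurable.stronglyMeasurable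
  exact ⟨integrable_dirac' hf (by simp), (integral_dirac' _ _ hf).symm⟩

/-- Every finite measure on a compact set has a regular version with the same barycenters. -/
lemma exists_regular_represents_of_represents [BorelSpace K] [CompactSpace K] [T2Space K]
    {μ : Measure K} [IsProbabilityMeasure μ] {x : E} (h : Represents μ x) :
    ∃ ν : Measure K, IsProbabilityMeasure ν ∧ ν.Regular ∧ Represents ν x := by
  obtain ⟨ν, hreg, hfin, hν⟩ := Measure.exists_regular_eq_of_compactSpace μ
  have hP : IsProbabilityMeasure ν := by
    -- Testing against the constant 1 shows that the total mass is preserved.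
    have := hν (BoundedContinuousFunction.const K 1)
    refine ⟨?_⟩
    have h1 : ν.real Set.univ = 1 := by simpa using this.symm
    simpa [Measure.real, ENNReal.toReal_eq_one_iff] using h1
  refine ⟨ν, hP, hreg, represents_iff_of_compactSpace.2 fun f => ?_⟩
  have hint (ρ : Measure K) [IsFiniteMeasure ρ] : Integrable (fun y : K => f y) ρ :=
    Continuous.integrable_of_hasCompactSupport (by fun_prop)
      (HasCompactSupport.of_compactSpace _)
  rw [represents_iff_of_compactSpace.1 h f]
  -- `hν` concerns real test functions, so real and imaginary parts are compared separately.
  apply Complex.ext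
  · have := hν (BoundedContinuousFunction.mkOfCompact ⟨fun y : K => (f y).re, by fun_prop⟩)
    exact ((Complex.reCLM.integral_comp_comm (hint μ)).symm.trans this).trans
      (Complex.reCLM.integral_comp_comm (hint ν))
  · have := hν (BoundedContinuousFunction.mkOfCompact ⟨fun y : K => (f y).im, by fun_prop⟩)
    exact ((Complex.imCLM.integral_comp_comm (hint μ)).symm.trans this).trans
      (Complex.imCLM.integral_comp_comm (hint ν))

/-- Every point of the closed convex hull of a compact set is the barycenter of a regular
probability measure on this set. -/
theorem exists_regular_represents [BorelSpace K] [Module ℝ E] [IsScalarTower ℝ ℂ E] [T2Space E]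
    (hK : IsCompact K) {x : E} (hx : x ∈ closedConvexHull ℝ K) :
    ∃ ν : Measure K, IsProbabilityMeasure ν ∧ ν.Regular ∧ Represents ν x := by
  have := isCompact_iff_compactSpace.1 hK
  have hsub : K ⊆ {x : E | ∃ μ : ProbabilityMeasure K, Represents (μ : Measure K) x} :=
    fun y hy => ⟨⟨Measure.dirac ⟨y, hy⟩, inferInstance⟩, represents_dirac ⟨y, hy⟩⟩
  obtain ⟨μ, hμ⟩ := closedConvexHull_min hsub convex_represented isClosed_represented hx
  exact exists_regular_represents_of_represents hμ

end Barycenter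

/-! ### Compactness of the state space and of the product states -/

section States

universe u v
variable {A : Type u} {B : Type v} [CStarAlgebra A] [CStarAlgebra B]

lemma norm_cyc (φ : stateSpace A) : ‖cyc φ‖ = 1 := by
  have h := cyc_inner φ 1
  rw [map_one, one_apply_eq_self, φ.2.2, inner_self_eq_norm_sq_to_K] at h
  have h' : ‖cyc φ‖ ^ 2 = 1 := Complex.ofReal_injective (by simpa using h)
  exact (pow_eq_one_iff_of_nonneg (norm_nonneg _) two_ne_zero).1 h'

/-- By GNS, `φ a` is a matrix coefficient at a unit vector, and *-homomorphisms are contractive. -/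
lemma norm_apply_le_of_mem_stateSpace {φ : WeakDual ℂ A} (hφ : φ ∈ stateSpace A) (a : A) :
    ‖φ a‖ ≤ ‖a‖ := by
  rw [← cyc_inner ⟨φ, hφ⟩ a]
  refine (norm_inner_le_norm _ _).trans ?_
  refine (mul_le_mul_of_nonneg_left (ContinuousLinearMap.le_opNorm _ _) (norm_nonneg _)).trans ?_
  rw [norm_cyc, one_mul, mul_one]
  exact NonUnitalStarAlgHom.norm_apply_le _ a

lemma isClosed_stateSpace : IsClosed (stateSpace A) := by
  simp only [stateSpace, Set.ofPred_and, Set.ofPred_forall]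
  exact (isClosed_iInter fun a => isClosed_le continuous_const (WeakDual.eval_continuous _)).inter
    (isClosed_eq (WeakDual.eval_continuous _) continuous_const)

/-- Reconciles the real scalars of the convex hull with the complex scalars of the test functionals.
-/
instance : IsScalarTower ℝ ℂ (WeakDual ℂ A) :=
  ⟨fun r c φ => DFunLike.ext _ _ fun a => smul_assoc r c (φ a)⟩

/-- Banach-Alaoglu: the states form a weak-* closed subset of the dual unit ball. -/
theorem isCompact_stateSpace : IsCompact (stateSpace A) :=
  (WeakDual.isCompact_closedBall (𝕜 := ℂ) (E := A) 0 1).of_isClosed_subset isClosed_stateSpace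
    fun φ hφ => by
      rw [Set.mem_preimage, mem_closedBall_zero_iff]
      exact ContinuousLinearMap.opNorm_le_bound _ zero_le_one fun a => by
        rw [one_mul]; exact norm_apply_le_of_mem_stateSpace hφ a

/-- The restriction of a state along a unital *-homomorphism. -/
lemma comp_mem_stateSpace {ω : WeakDual ℂ B} (hω : ω ∈ stateSpace B) (j : A →⋆ₐ[ℂ] B) :
    ∃ φ ∈ stateSpace A, ∀ a, φ a = ω (j a) := by
  refine ⟨StrongDual.toWeakDual ((WeakDual.toStrongDual ω).comp
    ⟨j.toAlgHom.toLinearMap,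
      AddMonoidHomClass.continuous_of_bound j 1 fun a => by
        rw [one_mul]; exact NonUnitalStarAlgHom.norm_apply_le j a⟩), ⟨fun a => ?_, ?_⟩, fun a => rfl⟩
  · change 0 ≤ ω (j (star a * a))
    rw [map_mul, map_star]
    exact hω.1 _
  · change ω (j 1) = 1
    rw [map_one, hω.2]

/-- The embedding `a ↦ a ⊗ 1`. -/
noncomputable def inclLeft : A →⋆ₐ[ℂ] InjTensor A B :=
  { (InjTensor.ofAlg A B).toAlgHom.comp Algebra.TensorProduct.includeLeft with
    map_star' := fun a => by
      change InjTensor.ofAlg A B (star a ⊗ₜ 1) = star (InjTensor.ofAlg A B (a ⊗ₜ 1))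
      rw [← map_star, TensorProduct.star_tmul, star_one] }

/-- The embedding `b ↦ 1 ⊗ b`. -/
noncomputable def inclRight : B →⋆ₐ[ℂ] InjTensor A B :=
  { (InjTensor.ofAlg A B).toAlgHom.comp Algebra.TensorProduct.includeRight with
    map_star' := fun b => by
      change InjTensor.ofAlg A B (1 ⊗ₜ star b) = star (InjTensor.ofAlg A B (1 ⊗ₜ b))
      rw [← map_star, TensorProduct.star_tmul, star_one] }

/-- The factors of a product state are forced to be its marginals `ω (a ⊗ 1)` and `ω (1 ⊗ b)`. This
removes the existential quantifiers over `φ` and `ψ`, leaving conditions on finitely many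
evaluations of `ω` at a time, hence weak-* closed ones. -/
lemma mem_productStates_iff {ω : WeakDual ℂ (InjTensor A B)} :
    ω ∈ productStates A B ↔ ω ∈ stateSpace (InjTensor A B) ∧
      ∀ a b, ω (InjTensor.tmul a b) = ω (InjTensor.tmul a 1) * ω (InjTensor.tmul 1 b) := by
  constructor
  · rintro ⟨φ, hφ, ψ, hψ, hω, h⟩
    exact ⟨hω, fun a b => by rw [h, h, h, hφ.2, hψ.2, mul_one, one_mul]⟩
  · rintro ⟨hω, h⟩
    obtain ⟨φ, hφ, hφω⟩ := comp_mem_stateSpace hω inclLeft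
    obtain ⟨ψ, hψ, hψω⟩ := comp_mem_stateSpace hω inclRight
    exact ⟨φ, hφ, ψ, hψ, hω, fun a b => by rw [hφω, hψω]; exact h a b⟩

theorem isCompact_productStates : IsCompact (productStates A B) := by
  refine isCompact_stateSpace.of_isClosed_subset ?_ fun ω hω => (mem_productStates_iff.1 hω).1
  have h : productStates A B = stateSpace (InjTensor A B) ∩ ⋂ (a : A) (b : B),
      {ω | ω (InjTensor.tmul a b) = ω (InjTensor.tmul a 1) * ω (InjTensor.tmul 1 b)} := by
    ext ω
    simp [mem_productStates_iff]
  rw [h]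
  exact isClosed_stateSpace.inter <| isClosed_iInter fun a => isClosed_iInter fun b =>
    isClosed_eq (WeakDual.eval_continuous _)
      ((WeakDual.eval_continuous _).mul (WeakDual.eval_continuous _))

end States

end CStarSep

theorem mainTheorem4 {A : Type*} {B : Type*} [CStarAlgebra A] [CStarAlgebra B] :
    IsCompact (CStarSep.productStates A B) ∧
    ∀ ω ∈ CStarSep.separableStates A B,
      ∃ ν : Measure (CStarSep.productStates A B),
        IsProbabilityMeasure ν ∧ ν.Regular ∧ CStarSep.Represents ν ω :=
  ⟨CStarSep.isCompact_productStates, fun _ hω =>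
    CStarSep.exists_regular_represents CStarSep.isCompact_productStates hω⟩
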